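/- There exists a monotone polygon that does not admit a hidden open edge guard set. Here a polygon $P$ is a simple polygon in the plane, given by the counterclockwise sequence of its vertices, no three consecutive ones collinear; its interior $\mathrm{int}(P)$ is the open set enclosed by its boundary $\partial P$. $P$ is monotone if it can be rotated so that every vertical line meets the closed region $\mathrm{int}(P)\cup\partial P$ in a connected (possibly empty) interval. An open edge is an edge of $P$ without its two endpoints. A set $S$ of open edges is a guard set if for every $l\in\mathrm{int}(P)$ there are $g\in S$ and $p\in g$ such that the relative interior of the segment $lp$ lies in $\mathrm{int}(P)$. $S$ is hidden if there are no two distinct $g_1,g_2\in S$ and points $p\in g_1$, $q\in g_2$ with $pq\setminus\{p,q\}\subseteq\mathrm{int}(P)$. -/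

import Mathlib

namespace Polygon

/-- The `i`-th edge of a polygon in the plane, without its two endpoints. -/
def openEdge {n : ℕ} (P : Polygon ℂ n) (i : Fin n) : Set ℂ :=
  openSegment ℝ (P i) (P (finRotate n i))

/-- The boundary of `P` is a simple closed polygonal chain: there are at least three vertices, they
are distinct, and the relative interior of an edge meets no other edge. Together these say that two
distinct edges can only meet in a common endpoint. -/
structure IsSimple {n : ℕ} (P : Polygon ℂ n) : Prop where
  three_le : 3 ≤ n
  injective : Function.Injective P.vertices
  disjoint : ∀ i j : Fin n, i ≠ j → Disjoint (P.openEdge i) (P.edgeSet ℝ j)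

/-- The vertices are listed in counterclockwise order, i.e. the signed area is positive. -/
def IsCounterclockwise {n : ℕ} (P : Polygon ℂ n) : Prop :=
  0 < ∑ i : Fin n,
    ((P i).re * (P (finRotate n i)).im - (P i).im * (P (finRotate n i)).re)

/-- The interior of `P`: the set enclosed by its boundary, i.e. the points off the boundary whose
connected component in the complement of the boundary is bounded. -/
def inside {n : ℕ} (P : Polygon ℂ n) : Set ℂ :=
  {z | z ∈ (P.boundary ℝ)ᶜ ∧ Bornology.IsBounded (connectedComponentIn (P.boundary ℝ)ᶜ z)}

/-- The closed region of the plane bounded by `P`. -/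
def region {n : ℕ} (P : Polygon ℂ n) : Set ℂ :=
  P.inside ∪ P.boundary ℝ

/-- `P` can be rotated so that every vertical line meets it in a connected
(possibly empty) interval. -/
def IsMonotone {n : ℕ} (P : Polygon ℂ n) : Prop :=
  ∃ a : Circle, ∀ c : ℝ, IsPreconnected ((rotation a '' P.region) ∩ {z : ℂ | z.re = c})

/-- The guard `g` sees the location `l`: for some point `p` of `g`, the relative interior of the
segment from `l` to `p` lies in the interior of the polygon. -/
def Sees {n : ℕ} (P : Polygon ℂ n) (g : Set ℂ) (l : ℂ) : Prop :=
  ∃ p ∈ g, openSegment ℝ l p ⊆ P.inside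

/-- The guards `g₁` and `g₂` see each other: the segment between some point of `g₁` and some point
of `g₂` lies in the interior of the polygon, except for its endpoints. -/
def SeeEachOther {n : ℕ} (P : Polygon ℂ n) (g₁ g₂ : Set ℂ) : Prop :=
  ∃ p ∈ g₁, ∃ q ∈ g₂, segment ℝ p q \ {p, q} ⊆ P.inside

/-- The open edges with index in `S` together see every location in the interior of `P`. -/
def IsOpenEdgeGuardSet {n : ℕ} (P : Polygon ℂ n) (S : Set (Fin n)) : Prop :=
  ∀ l ∈ P.inside, ∃ i ∈ S, P.Sees (P.openEdge i) l

/-- No two different open edges with index in `S` see each other. -/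
def IsHiddenOpenEdgeSet {n : ℕ} (P : Polygon ℂ n) (S : Set (Fin n)) : Prop :=
  ∀ i ∈ S, ∀ j ∈ S, i ≠ j → ¬ P.SeeEachOther (P.openEdge i) (P.openEdge j)

/-- `P` admits a hidden open edge guard set. -/
def AdmitsHiddenOpenEdgeGuardSet {n : ℕ} (P : Polygon ℂ n) : Prop :=
  ∃ S : Set (Fin n), P.IsOpenEdgeGuardSet S ∧ P.IsHiddenOpenEdgeSet S

end Polygon

open Set Topology

namespace Polygon


/-! The witness is an explicit 12-gon, symmetric under `z ↦ -z`, which sends edge `i` to edge `i +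
6`. A point near the leftmost vertex is seen only by the edges 11, 8, 0
(`eq_of_sees_near_leftmost`), and a point in the upper left spike only by 10, 9, 1
(`eq_of_sees_in_left_spike`); by symmetry 5, 2, 6 and 4, 3, 7 are the only guards of the opposite
points. A guard set therefore meets all four triples.

The lemmas `seeEachOther_dodecagon_*` and their mirror images give the conflicts. An edge 11 or 8
excludes 4, 7, 5 and 2, which forces both 3 and 6; but these see each other. By symmetry 5 and 2 are
impossible too, so 0 and 6 are guards. They exclude 9 and 3, which leaves one of 10, 1 together with
one of 4, 7, and each such pair conflicts.

Visibility becomes linear arithmetic once the interior is identified with the region between two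
piecewise linear graphs (`inside_dodecagon`). -/

theorem mem_segment_iff_re_im {a b z : ℂ} : z ∈ segment ℝ a b ↔
    ∃ t : ℝ, 0 ≤ t ∧ t ≤ 1 ∧ z.re = a.re + t * (b.re - a.re) ∧ z.im = a.im + t * (b.im - a.im) := by
  rw [segment_eq_image']
  constructor
  · rintro ⟨t, ⟨h0, h1⟩, rfl⟩
    exact ⟨t, h0, h1, by simp, by simp⟩
  · rintro ⟨t, h0, h1, hr, hi⟩
    exact ⟨t, ⟨h0, h1⟩, Complex.ext (by simp [hr]) (by simp [hi])⟩

theorem mem_openSegment_iff_re_im {a b z : ℂ} : z ∈ openSegment ℝ a b ↔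
    ∃ t : ℝ, 0 < t ∧ t < 1 ∧ z.re = a.re + t * (b.re - a.re) ∧ z.im = a.im + t * (b.im - a.im) := by
  rw [openSegment_eq_image']
  constructor
  · rintro ⟨t, ⟨h0, h1⟩, rfl⟩
    exact ⟨t, h0, h1, by simp, by simp⟩
  · rintro ⟨t, h0, h1, hr, hi⟩
    exact ⟨t, ⟨h0, h1⟩, Complex.ext (by simp [hr]) (by simp [hi])⟩

theorem affineIndependent_of_cross_ne_zero {a b c : ℂ}
    (h : (b.re - a.re) * (c.im - a.im) - (b.im - a.im) * (c.re - a.re) ≠ 0) :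
    AffineIndependent ℝ ![a, b, c] := by
  rw [affineIndependent_iff_not_collinear_set]
  intro hc
  rw [collinear_iff_of_mem (p₀ := a) (by simp)] at hc
  obtain ⟨v, hv⟩ := hc
  obtain ⟨r, hr⟩ := hv b (by simp)
  obtain ⟨s, hs⟩ := hv c (by simp)
  apply h
  rw [hr, hs]
  simp
  ring

/-! ### The polygon and its simplicity -/

/-- The abscissas of the vertices of `dodecagon`. -/
def dodecagonRe : Fin 12 → ℝ := ![-12, -9, 0, 5, 6, 7, 12, 9, 0, -5, -6, -7]

/-- The ordinates of the vertices of `dodecagon`. -/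
def dodecagonIm : Fin 12 → ℝ := ![-12, -6, -9, -5, -10, 0, 12, 6, 9, 5, 10, 0]

/-- A monotone polygon, symmetric about the origin. The edges `0, …, 5` form its lower chain, from
left to right, and the edges `6, …, 11` its upper chain, from right to left. -/
def dodecagon : Polygon ℂ 12 := ⟨fun i => ⟨dodecagonRe i, dodecagonIm i⟩⟩

theorem dodecagon_re (i : Fin 12) : (dodecagon i).re = dodecagonRe i := rfl

theorem dodecagon_im (i : Fin 12) : (dodecagon i).im = dodecagonIm i := rfl

theorem mem_openEdge_dodecagon {i : Fin 12} {z : ℂ} : z ∈ dodecagon.openEdge i ↔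
    ∃ t : ℝ, 0 < t ∧ t < 1 ∧ z.re = dodecagonRe i + t * (dodecagonRe (i + 1) - dodecagonRe i) ∧
      z.im = dodecagonIm i + t * (dodecagonIm (i + 1) - dodecagonIm i) := by
  rw [openEdge, mem_openSegment_iff_re_im, finRotate_apply]
  rfl

theorem mem_edgeSet_dodecagon {i : Fin 12} {z : ℂ} : z ∈ dodecagon.edgeSet ℝ i ↔
    ∃ t : ℝ, 0 ≤ t ∧ t ≤ 1 ∧ z.re = dodecagonRe i + t * (dodecagonRe (i + 1) - dodecagonRe i) ∧
      z.im = dodecagonIm i + t * (dodecagonIm (i + 1) - dodecagonIm i) := by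
  rw [edgeSet, affineSegment_eq_segment, mem_segment_iff_re_im, finRotate_apply]
  rfl

theorem dodecagon_hasNondegenerateVertices : dodecagon.HasNondegenerateVertices ℝ := by
  intro i
  apply affineIndependent_of_cross_ne_zero
  simp only [dodecagon_re, dodecagon_im]
  fin_cases i <;> simp [dodecagonRe, dodecagonIm, Fin.add_def] <;> norm_num

theorem dodecagon_isCounterclockwise : dodecagon.IsCounterclockwise := by
  unfold IsCounterclockwise
  simp only [dodecagon_re, dodecagon_im, finRotate_apply, Fin.sum_univ_succ]
  norm_num [dodecagonRe, dodecagonIm, Fin.add_def, Fin.succ]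

theorem dodecagon_injective : Function.Injective dodecagon.vertices := by
  intro i j h
  have hr : dodecagonRe i = dodecagonRe j := congrArg Complex.re h
  have hi : dodecagonIm i = dodecagonIm j := congrArg Complex.im h
  fin_cases i <;> fin_cases j <;> first | rfl | (exfalso; norm_num [dodecagonRe] at hr <;>
      norm_num [dodecagonIm] at hi)

theorem disjoint_dodecagon_edges (i j : Fin 12) (hij : i ≠ j) :
    Disjoint (dodecagon.openEdge i) (dodecagon.edgeSet ℝ j) := by
  rw [Set.disjoint_left]
  intro z hz hz'
  obtain ⟨s, hs0, hs1, hr, hi⟩ := mem_openEdge_dodecagon.1 hz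
  obtain ⟨t, ht0, ht1, hr', hi'⟩ := mem_edgeSet_dodecagon.1 hz'
  rw [hr] at hr'
  rw [hi] at hi'
  clear hr hi hz hz'
  -- For each pair, two linear equations in `s` and `t` have no solution in the given ranges; for
  -- adjacent edges the strict bounds on `s` rule out the common vertex.
  fin_cases i <;> fin_cases j <;> first
    | exact hij rfl
    | (norm_num [dodecagonRe, Fin.add_def] at hr'; norm_num [dodecagonIm, Fin.add_def] at hi'
       linarith)

theorem dodecagon_isSimple : dodecagon.IsSimple :=
  ⟨by norm_num, dodecagon_injective, disjoint_dodecagon_edges⟩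


/-! ### The two chains, the interior and monotonicity -/

/-- The piecewise linear function whose graph over `[-12, 12]` is the upper chain of `dodecagon`. -/
noncomputable def upperChain (x : ℝ) : ℝ :=
  12 / 5 * (x + 7) + 38 / 5 * max 0 (x + 7) - 15 * max 0 (x + 6) + 29 / 5 * max 0 (x + 5)
    - 17 / 15 * max 0 x + 7 / 3 * max 0 (x - 9)

/-- The piecewise linear function whose graph over `[-12, 12]` is the lower chain of `dodecagon`. -/
noncomputable def lowerChain (x : ℝ) : ℝ := -upperChain (-x)

theorem continuous_upperChain : Continuous upperChain := by
  unfold upperChain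
  fun_prop

theorem continuous_lowerChain : Continuous lowerChain :=
  (continuous_upperChain.comp continuous_neg).neg

/-- The coefficients of the `max` terms are the jumps of slope at the breakpoints; the successive
slopes are 12/5, 10, -5, 4/5, -1/3, 2. -/
theorem upperChain_cases (x : ℝ) :
    x ≤ -7 ∧ upperChain x = 12 / 5 * (x + 7) ∨
    (-7 ≤ x ∧ x ≤ -6) ∧ upperChain x = 10 * (x + 7) ∨
    (-6 ≤ x ∧ x ≤ -5) ∧ upperChain x = 5 - 5 * (x + 5) ∨
    (-5 ≤ x ∧ x ≤ 0) ∧ upperChain x = 9 + 4 / 5 * x ∨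
    (0 ≤ x ∧ x ≤ 9) ∧ upperChain x = 9 - x / 3 ∨
    9 ≤ x ∧ upperChain x = 12 + 2 * (x - 12) := by
  unfold upperChain
  rcases le_total x (-7) with h1 | h1
  · rw [max_eq_left (by linarith), max_eq_left (by linarith), max_eq_left (by linarith),
      max_eq_left (by linarith), max_eq_left (by linarith)]
    exact Or.inl ⟨h1, by ring⟩
  rw [max_eq_right (by linarith : 0 ≤ x + 7)]
  rcases le_total x (-6) with h2 | h2
  · rw [max_eq_left (by linarith), max_eq_left (by linarith), max_eq_left (by linarith),
      max_eq_left (by linarith)]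
    exact Or.inr (Or.inl ⟨⟨h1, h2⟩, by ring⟩)
  rw [max_eq_right (by linarith : 0 ≤ x + 6)]
  rcases le_total x (-5) with h3 | h3
  · rw [max_eq_left (by linarith), max_eq_left (by linarith), max_eq_left (by linarith)]
    exact Or.inr (Or.inr (Or.inl ⟨⟨h2, h3⟩, by ring⟩))
  rw [max_eq_right (by linarith : 0 ≤ x + 5)]
  rcases le_total x 0 with h4 | h4
  · rw [max_eq_left (by linarith), max_eq_left (by linarith)]
    exact Or.inr (Or.inr (Or.inr (Or.inl ⟨⟨h3, h4⟩, by ring⟩)))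
  rw [max_eq_right (by linarith : 0 ≤ x)]
  rcases le_total x 9 with h5 | h5
  · rw [max_eq_left (by linarith)]
    exact Or.inr (Or.inr (Or.inr (Or.inr (Or.inl ⟨⟨h4, h5⟩, by ring⟩))))
  rw [max_eq_right (by linarith : 0 ≤ x - 9)]
  exact Or.inr (Or.inr (Or.inr (Or.inr (Or.inr ⟨h5, by ring⟩))))

theorem lowerChain_cases (x : ℝ) :
    x ≤ -9 ∧ lowerChain x = -12 + 2 * (x + 12) ∨
    (-9 ≤ x ∧ x ≤ 0) ∧ lowerChain x = -9 - x / 3 ∨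
    (0 ≤ x ∧ x ≤ 5) ∧ lowerChain x = -9 + 4 / 5 * x ∨
    (5 ≤ x ∧ x ≤ 6) ∧ lowerChain x = -5 - 5 * (x - 5) ∨
    (6 ≤ x ∧ x ≤ 7) ∧ lowerChain x = 10 * (x - 7) ∨
    7 ≤ x ∧ lowerChain x = 12 / 5 * (x - 7) := by
  unfold lowerChain
  rcases upperChain_cases (-x) with h | h | h | h | h | h <;> rw [h.2]
  · exact Or.inr (Or.inr (Or.inr (Or.inr (Or.inr ⟨by linarith, by ring⟩))))
  · exact Or.inr (Or.inr (Or.inr (Or.inr (Or.inl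
      ⟨⟨by linarith [h.1.2], by linarith [h.1.1]⟩, by ring⟩))))
  · exact Or.inr (Or.inr (Or.inr (Or.inl ⟨⟨by linarith [h.1.2], by linarith [h.1.1]⟩, by ring⟩)))
  · exact Or.inr (Or.inr (Or.inl ⟨⟨by linarith [h.1.2], by linarith [h.1.1]⟩, by ring⟩))
  · exact Or.inr (Or.inl ⟨⟨by linarith [h.1.2], by linarith [h.1.1]⟩, by ring⟩)
  · exact Or.inl ⟨by linarith, by ring⟩

/-- The part of the plane strictly between the two chains. -/
def betweenChains : Set ℂ := {z | lowerChain z.re < z.im ∧ z.im < upperChain z.re}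

/-- The part of the plane strictly below the lower chain or strictly above the upper chain. -/
def beyondChains : Set ℂ := {z | z.im < lowerChain z.re ∨ upperChain z.re < z.im}

theorem isOpen_betweenChains : IsOpen betweenChains :=
  (isOpen_lt (continuous_lowerChain.comp Complex.continuous_re) Complex.continuous_im).inter
    (isOpen_lt Complex.continuous_im (continuous_upperChain.comp Complex.continuous_re))

theorem isOpen_beyondChains : IsOpen beyondChains :=
  (isOpen_lt Complex.continuous_im (continuous_lowerChain.comp Complex.continuous_re)).union
    (isOpen_lt (continuous_upperChain.comp Complex.continuous_re) Complex.continuous_im)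

theorem disjoint_betweenChains_beyondChains : Disjoint betweenChains beyondChains := by
  rw [Set.disjoint_left]
  rintro z ⟨h1, h2⟩ (h | h) <;> linarith

/-- The chains meet at the two extreme vertices, and their extensions cross there. Hence every point
with abscissa outside `[-12, 12]` lies in `beyondChains`. -/
theorem lowerChain_le_upperChain_iff {x : ℝ} :
    lowerChain x ≤ upperChain x ↔ -12 ≤ x ∧ x ≤ 12 := by
  rcases upperChain_cases x with h | h | h | h | h | h <;>
  rcases lowerChain_cases x with h' | h' | h' | h' | h' | h' <;>
  rw [h.2, h'.2] <;> obtain ⟨h, -⟩ := h <;> obtain ⟨h', -⟩ := h' <;>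
  constructor <;> intro hx <;> (try constructor) <;> linarith [hx, h, h']

theorem mem_boundary_dodecagon_iff {z : ℂ} : z ∈ dodecagon.boundary ℝ ↔
    (-12 ≤ z.re ∧ z.re ≤ 12) ∧ (z.im = lowerChain z.re ∨ z.im = upperChain z.re) := by
  simp only [boundary, mem_iUnion, mem_edgeSet_dodecagon]
  constructor
  · rintro ⟨i, t, h0, h1, hr, hi⟩
    fin_cases i <;> norm_num [dodecagonRe, Fin.add_def] at hr <;>
      norm_num [dodecagonIm, Fin.add_def] at hi <;>
      refine ⟨⟨by linarith, by linarith⟩, ?_⟩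
    iterate 6
      left
      rcases lowerChain_cases z.re with ⟨h', e⟩ | ⟨h', e⟩ | ⟨h', e⟩ | ⟨h', e⟩ | ⟨h', e⟩ | ⟨h', e⟩ <;>
        linarith
    iterate 6
      right
      rcases upperChain_cases z.re with ⟨h', e⟩ | ⟨h', e⟩ | ⟨h', e⟩ | ⟨h', e⟩ | ⟨h', e⟩ | ⟨h', e⟩ <;>
        linarith
  · rintro ⟨⟨h1, h2⟩, h | h⟩
    · rcases lowerChain_cases z.re with ⟨h', e⟩ | ⟨h', e⟩ | ⟨h', e⟩ | ⟨h', e⟩ | ⟨h', e⟩ | ⟨h', e⟩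
      -- Here and below, the parameter along the edge solves the equation for the abscissa.
      · refine ⟨0, (z.re + 12) / 3, by linarith, by linarith, ?_, ?_⟩ <;>
          simp [dodecagonRe, dodecagonIm] <;> linarith
      · refine ⟨1, (z.re + 9) / 9, by linarith, by linarith, ?_, ?_⟩ <;>
          simp [dodecagonRe, dodecagonIm]
        linarith
      · refine ⟨2, (z.re) / 5, by linarith, by linarith, ?_, ?_⟩ <;>
          simp [dodecagonRe, dodecagonIm]
        linarith
      · refine ⟨3, z.re - 5, by linarith, by linarith, ?_, ?_⟩ <;>
          simp [dodecagonRe, dodecagonIm] <;> linarith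
      · refine ⟨4, z.re - 6, by linarith, by linarith, ?_, ?_⟩ <;>
          simp [dodecagonRe, dodecagonIm] <;> linarith
      · refine ⟨5, (z.re - 7) / 5, by linarith, by linarith, ?_, ?_⟩ <;>
          simp [dodecagonRe, dodecagonIm] <;> linarith
    · rcases upperChain_cases z.re with ⟨h', e⟩ | ⟨h', e⟩ | ⟨h', e⟩ | ⟨h', e⟩ | ⟨h', e⟩ | ⟨h', e⟩
      · refine ⟨11, (-7 - z.re) / 5, by linarith, by linarith, ?_, ?_⟩ <;>
          simp [dodecagonRe, dodecagonIm] <;> linarith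
      · refine ⟨10, -6 - z.re, by linarith, by linarith, ?_, ?_⟩ <;>
          simp [dodecagonRe, dodecagonIm] <;> linarith
      · refine ⟨9, -5 - z.re, by linarith, by linarith, ?_, ?_⟩ <;>
          simp [dodecagonRe, dodecagonIm] <;> linarith
      · refine ⟨8, (-z.re) / 5, by linarith, by linarith, ?_, ?_⟩ <;>
          simp [dodecagonRe, dodecagonIm]
        linarith
      · refine ⟨7, (9 - z.re) / 9, by linarith, by linarith, ?_, ?_⟩ <;>
          simp [dodecagonRe, dodecagonIm]
        linarith
      · refine ⟨6, (12 - z.re) / 3, by linarith, by linarith, ?_, ?_⟩ <;>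
          simp [dodecagonRe, dodecagonIm] <;> linarith

theorem compl_boundary_dodecagon : (dodecagon.boundary ℝ)ᶜ = betweenChains ∪ beyondChains := by
  ext z
  rw [mem_compl_iff, mem_boundary_dodecagon_iff, ← lowerChain_le_upperChain_iff]
  simp only [betweenChains, beyondChains, mem_union, mem_ofPred_eq]
  constructor
  · intro h
    by_contra! hz
    obtain ⟨hz1, hz2, hz3⟩ := hz
    refine h ⟨hz2.trans hz3, ?_⟩
    rcases hz2.eq_or_lt with he | hlt
    · exact Or.inl he.symm
    · exact Or.inr (hz3.antisymm (hz1 hlt))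
  · rintro (⟨ha, hb⟩ | ha | ha) ⟨hc, hd | hd⟩ <;> linarith

theorem isBounded_betweenChains : Bornology.IsBounded betweenChains := by
  refine (Metric.isBounded_closedBall (x := (0 : ℂ)) (r := 24)).subset fun z hz => ?_
  rw [mem_closedBall_zero_iff]
  obtain ⟨h1, h2⟩ := hz
  obtain ⟨h3, h4⟩ := lowerChain_le_upperChain_iff.1 (h1.trans h2).le
  have hu : upperChain z.re ≤ 12 := by
    rcases upperChain_cases z.re with ⟨h', e⟩ | ⟨h', e⟩ | ⟨h', e⟩ | ⟨h', e⟩ | ⟨h', e⟩ | ⟨h', e⟩ <;>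
      linarith
  have hl : -12 ≤ lowerChain z.re := by
    rcases lowerChain_cases z.re with ⟨h', e⟩ | ⟨h', e⟩ | ⟨h', e⟩ | ⟨h', e⟩ | ⟨h', e⟩ | ⟨h', e⟩ <;>
      linarith
  have hr : |z.re| ≤ 12 := abs_le.2 ⟨by linarith, by linarith⟩
  have hi : |z.im| ≤ 12 := abs_le.2 ⟨by linarith, by linarith⟩
  linarith [Complex.norm_le_abs_re_add_abs_im z]

/-- A set of complex numbers that contains vertical translates of a point by arbitrarily large
distances is unbounded. -/
theorem not_isBounded_of_forall_add_mul_I_mem {s : Set ℂ} {z : ℂ} {ε : ℝ} (hε : |ε| = 1)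
    (h : ∀ t : ℝ, 0 ≤ t → z + (ε * t : ℝ) * Complex.I ∈ s) : ¬ Bornology.IsBounded s := by
  intro hb
  obtain ⟨C, hC⟩ := hb.exists_norm_le
  have h1 := hC _ (h (|C| + ‖z‖ + 1) (by positivity))
  have h2 := norm_sub_le (z + (ε * (|C| + ‖z‖ + 1) : ℝ) * Complex.I) z
  rw [add_sub_cancel_left, norm_mul, Complex.norm_I, mul_one, Complex.norm_real, Real.norm_eq_abs,
    abs_mul, hε, one_mul, abs_of_nonneg (by positivity)] at h2
  linarith [le_abs_self C]

/-- A vertical ray avoiding the boundary is connected, so it lies in the component of its origin,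
which is then unbounded. -/
theorem notMem_inside_of_ray {n : ℕ} {P : Polygon ℂ n} {z : ℂ} {ε : ℝ} (hε : |ε| = 1)
    (h : ∀ t : ℝ, 0 ≤ t → z + (ε * t : ℝ) * Complex.I ∉ P.boundary ℝ) : z ∉ P.inside := by
  rintro ⟨-, hb⟩
  refine not_isBounded_of_forall_add_mul_I_mem (z := z) hε (fun t ht => ?_) hb
  have hpre : IsPreconnected ((fun t : ℝ => z + (ε * t : ℝ) * Complex.I) '' Ici 0) :=
    isPreconnected_Ici.image _ (by fun_prop)
  refine hpre.subset_connectedComponentIn ⟨0, self_mem_Ici, by simp⟩ ?_ ⟨t, ht, rfl⟩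
  rintro _ ⟨s, hs, rfl⟩
  exact h s hs

/-- Points beyond the chains escape along a vertical ray. A component meeting the bounded set
`betweenChains` stays in it, because the complement of the boundary is the disjoint union of two
open sets. -/
theorem inside_dodecagon : dodecagon.inside = betweenChains := by
  apply Subset.antisymm
  · intro z hz
    have hz' : z ∈ betweenChains ∪ beyondChains := compl_boundary_dodecagon ▸ hz.1
    rcases hz' with h | h | h
    · exact h
    · refine absurd hz (notMem_inside_of_ray (ε := -1) (by simp) fun t ht => ?_)
      rw [← mem_compl_iff, compl_boundary_dodecagon]
      refine Or.inr (Or.inl ?_)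
      simp
      linarith
    · refine absurd hz (notMem_inside_of_ray (ε := 1) (by simp) fun t ht => ?_)
      rw [← mem_compl_iff, compl_boundary_dodecagon]
      refine Or.inr (Or.inr ?_)
      simp
      linarith
  · intro z hz
    have hz' : z ∈ (dodecagon.boundary ℝ)ᶜ := compl_boundary_dodecagon ▸ Or.inl hz
    refine ⟨hz', isBounded_betweenChains.subset ?_⟩
    refine isPreconnected_connectedComponentIn.subset_left_of_subset_union isOpen_betweenChains
      isOpen_beyondChains disjoint_betweenChains_beyondChains ?_
      ⟨z, mem_connectedComponentIn hz', hz⟩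
    rw [← compl_boundary_dodecagon]
    exact connectedComponentIn_subset _ _

theorem region_dodecagon :
    dodecagon.region = {z | lowerChain z.re ≤ z.im ∧ z.im ≤ upperChain z.re} := by
  ext z
  rw [region, inside_dodecagon, mem_union, mem_boundary_dodecagon_iff,
    ← lowerChain_le_upperChain_iff]
  simp only [betweenChains, mem_ofPred_eq]
  constructor
  · rintro (⟨ha, hb⟩ | ⟨ha, hb | hb⟩) <;> constructor <;> linarith
  · rintro ⟨ha, hb⟩
    rcases ha.eq_or_lt with he | hlt
    · exact Or.inr ⟨ha.trans hb, Or.inl he.symm⟩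
    rcases hb.eq_or_lt with he | hlt'
    · exact Or.inr ⟨ha.trans hb, Or.inr he⟩
    · exact Or.inl ⟨hlt, hlt'⟩

theorem dodecagon_isMonotone : dodecagon.IsMonotone := by
  refine ⟨1, fun c => ?_⟩
  have h : (rotation 1 '' dodecagon.region) ∩ {z : ℂ | z.re = c} =
      (fun t : ℝ => (⟨c, t⟩ : ℂ)) '' Icc (lowerChain c) (upperChain c) := by
    ext z
    simp only [map_one, LinearIsometryEquiv.coe_one, image_id, region_dodecagon, mem_inter_iff,
      mem_ofPred_eq, mem_image, mem_Icc]
    constructor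
    · rintro ⟨hz, rfl⟩
      exact ⟨z.im, hz, rfl⟩
    · rintro ⟨t, ht, rfl⟩
      exact ⟨ht, rfl⟩
  rw [h]
  refine isPreconnected_Icc.image _ (Continuous.continuousOn ?_)
  have : (fun t : ℝ => (⟨c, t⟩ : ℂ)) = fun t : ℝ => (c : ℂ) + t * Complex.I := by
    funext t
    exact Complex.mk_eq_add_mul_I c t
  rw [this]
  fun_prop


/-! ### Central symmetry -/

theorem dodecagonRe_add_six (i : Fin 12) : dodecagonRe (i + 6) = -dodecagonRe i := by
  fin_cases i <;> simp [dodecagonRe]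

theorem dodecagonIm_add_six (i : Fin 12) : dodecagonIm (i + 6) = -dodecagonIm i := by
  fin_cases i <;> simp [dodecagonIm]

theorem neg_mem_openEdge_add_six {i : Fin 12} {z : ℂ} (hz : z ∈ dodecagon.openEdge i) :
    -z ∈ dodecagon.openEdge (i + 6) := by
  obtain ⟨t, h0, h1, hr, hi⟩ := mem_openEdge_dodecagon.1 hz
  refine mem_openEdge_dodecagon.2 ⟨t, h0, h1, ?_, ?_⟩
  · rw [add_right_comm, dodecagonRe_add_six, dodecagonRe_add_six, Complex.neg_re, hr]
    ring
  · rw [add_right_comm, dodecagonIm_add_six, dodecagonIm_add_six, Complex.neg_im, hi]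
    ring

theorem neg_mem_betweenChains {z : ℂ} : -z ∈ betweenChains ↔ z ∈ betweenChains := by
  simp only [betweenChains, lowerChain, mem_ofPred_eq, Complex.neg_re, Complex.neg_im, neg_neg,
    neg_lt_neg_iff]
  rw [and_comm, neg_lt]

theorem SeeEachOther.add_six {i j : Fin 12}
    (h : dodecagon.SeeEachOther (dodecagon.openEdge i) (dodecagon.openEdge j)) :
    dodecagon.SeeEachOther (dodecagon.openEdge (i + 6)) (dodecagon.openEdge (j + 6)) := by
  obtain ⟨p, hp, q, hq, h⟩ := h
  rw [inside_dodecagon] at h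
  refine ⟨-p, neg_mem_openEdge_add_six hp, -q, neg_mem_openEdge_add_six hq, ?_⟩
  rw [inside_dodecagon]
  rintro z ⟨hz, hne⟩
  rw [← neg_mem_betweenChains]
  refine h ⟨?_, fun hc => hne ?_⟩
  · obtain ⟨a, b, ha, hb, hab, rfl⟩ := hz
    exact ⟨a, b, ha, hb, hab, by simp only [smul_neg]; ring⟩
  · rcases hc with hc | hc
    · exact Or.inl (neg_eq_iff_eq_neg.1 hc)
    · exact Or.inr (neg_eq_iff_eq_neg.1 hc)

theorem Sees.add_six {i : Fin 12} {l : ℂ} (h : dodecagon.Sees (dodecagon.openEdge i) l) :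
    dodecagon.Sees (dodecagon.openEdge (i + 6)) (-l) := by
  obtain ⟨p, hp, h⟩ := h
  rw [inside_dodecagon] at h
  refine ⟨-p, neg_mem_openEdge_add_six hp, ?_⟩
  rw [inside_dodecagon]
  intro z hz
  rw [← neg_mem_betweenChains]
  apply h
  obtain ⟨a, b, ha, hb, hab, rfl⟩ := hz
  exact ⟨a, b, ha, hb, hab, by simp only [smul_neg]; ring⟩

/-! ### Pairs of edges that see each other -/

/-- The parameters `s` and `t` place one point on each edge. For numerical values, `x` and `y` are
affine in `r`, so `h` reduces to linear inequalities on each piece of the chains. -/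
theorem seeEachOther_dodecagon {i j : Fin 12} (s t : ℝ) (hs : 0 < s ∧ s < 1) (ht : 0 < t ∧ t < 1)
    (h : ∀ r x y : ℝ, 0 < r → r < 1 →
      x = (1 - r) * (dodecagonRe i + s * (dodecagonRe (i + 1) - dodecagonRe i)) +
        r * (dodecagonRe j + t * (dodecagonRe (j + 1) - dodecagonRe j)) →
      y = (1 - r) * (dodecagonIm i + s * (dodecagonIm (i + 1) - dodecagonIm i)) +
        r * (dodecagonIm j + t * (dodecagonIm (j + 1) - dodecagonIm j)) →
      lowerChain x < y ∧ y < upperChain x) :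
    dodecagon.SeeEachOther (dodecagon.openEdge i) (dodecagon.openEdge j) := by
  refine ⟨⟨dodecagonRe i + s * (dodecagonRe (i + 1) - dodecagonRe i),
      dodecagonIm i + s * (dodecagonIm (i + 1) - dodecagonIm i)⟩,
    mem_openEdge_dodecagon.2 ⟨s, hs.1, hs.2, rfl, rfl⟩,
    ⟨dodecagonRe j + t * (dodecagonRe (j + 1) - dodecagonRe j),
      dodecagonIm j + t * (dodecagonIm (j + 1) - dodecagonIm j)⟩,
    mem_openEdge_dodecagon.2 ⟨t, ht.1, ht.2, rfl, rfl⟩, ?_⟩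
  rintro z ⟨hz, hne⟩
  obtain ⟨r, h0, h1, hr, hi⟩ := mem_segment_iff_re_im.1 hz
  dsimp only at hr hi
  rw [inside_dodecagon]
  refine h r z.re z.im (h0.lt_of_ne ?_) (h1.lt_of_ne ?_) (by rw [hr]; ring) (by rw [hi]; ring)
  · rintro rfl
    exact hne (Or.inl (Complex.ext (by simp [hr]) (by simp [hi])))
  · rintro rfl
    exact hne (Or.inr (Complex.ext (by simp [hr]) (by simp [hi])))

theorem seeEachOther_dodecagon_3_6 :
    dodecagon.SeeEachOther (dodecagon.openEdge 3) (dodecagon.openEdge 6) := by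
  -- The points are taken close to the vertices (5, -5) and (9, 6), so that the segment passes just
  -- above the vertex (7, 0).
  refine seeEachOther_dodecagon (1 / 12) (7 / 8) (by norm_num) (by norm_num) fun r x y h0 h1 hx hy => ?_
  simp [dodecagonRe, dodecagonIm] at hx hy
  exact ⟨by rcases lowerChain_cases x with h | h | h | h | h | h <;> linarith,
    by rcases upperChain_cases x with h | h | h | h | h | h <;> linarith⟩

theorem seeEachOther_dodecagon_11_7 :
    dodecagon.SeeEachOther (dodecagon.openEdge 11) (dodecagon.openEdge 7) := by
  refine seeEachOther_dodecagon (1 / 2) (1 / 2) (by norm_num) (by norm_num) fun r x y h0 h1 hx hy => ?_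
  simp [dodecagonRe, dodecagonIm] at hx hy
  exact ⟨by rcases lowerChain_cases x with h | h | h | h | h | h <;> linarith,
    by rcases upperChain_cases x with h | h | h | h | h | h <;> linarith⟩

theorem seeEachOther_dodecagon_11_4 :
    dodecagon.SeeEachOther (dodecagon.openEdge 11) (dodecagon.openEdge 4) := by
  refine seeEachOther_dodecagon (1 / 2) (2 / 3) (by norm_num) (by norm_num) fun r x y h0 h1 hx hy => ?_
  simp [dodecagonRe, dodecagonIm] at hx hy
  exact ⟨by rcases lowerChain_cases x with h | h | h | h | h | h <;> linarith,
    by rcases upperChain_cases x with h | h | h | h | h | h <;> linarith⟩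

theorem seeEachOther_dodecagon_11_2 :
    dodecagon.SeeEachOther (dodecagon.openEdge 11) (dodecagon.openEdge 2) := by
  refine seeEachOther_dodecagon (1 / 3) (1 / 2) (by norm_num) (by norm_num) fun r x y h0 h1 hx hy => ?_
  simp [dodecagonRe, dodecagonIm] at hx hy
  exact ⟨by rcases lowerChain_cases x with h | h | h | h | h | h <;> linarith,
    by rcases upperChain_cases x with h | h | h | h | h | h <;> linarith⟩

theorem seeEachOther_dodecagon_11_5 :
    dodecagon.SeeEachOther (dodecagon.openEdge 11) (dodecagon.openEdge 5) := by
  refine seeEachOther_dodecagon (1 / 2) (1 / 2) (by norm_num) (by norm_num) fun r x y h0 h1 hx hy => ?_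
  simp [dodecagonRe, dodecagonIm] at hx hy
  exact ⟨by rcases lowerChain_cases x with h | h | h | h | h | h <;> linarith,
    by rcases upperChain_cases x with h | h | h | h | h | h <;> linarith⟩

theorem seeEachOther_dodecagon_8_7 :
    dodecagon.SeeEachOther (dodecagon.openEdge 8) (dodecagon.openEdge 7) := by
  refine seeEachOther_dodecagon (1 / 2) (1 / 2) (by norm_num) (by norm_num) fun r x y h0 h1 hx hy => ?_
  simp [dodecagonRe, dodecagonIm] at hx hy
  exact ⟨by rcases lowerChain_cases x with h | h | h | h | h | h <;> linarith,
    by rcases upperChain_cases x with h | h | h | h | h | h <;> linarith⟩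

theorem seeEachOther_dodecagon_8_4 :
    dodecagon.SeeEachOther (dodecagon.openEdge 8) (dodecagon.openEdge 4) := by
  refine seeEachOther_dodecagon (1 / 2) (1 / 2) (by norm_num) (by norm_num) fun r x y h0 h1 hx hy => ?_
  simp [dodecagonRe, dodecagonIm] at hx hy
  exact ⟨by rcases lowerChain_cases x with h | h | h | h | h | h <;> linarith,
    by rcases upperChain_cases x with h | h | h | h | h | h <;> linarith⟩

theorem seeEachOther_dodecagon_8_2 :
    dodecagon.SeeEachOther (dodecagon.openEdge 8) (dodecagon.openEdge 2) := by
  refine seeEachOther_dodecagon (1 / 2) (1 / 2) (by norm_num) (by norm_num) fun r x y h0 h1 hx hy => ?_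
  simp [dodecagonRe, dodecagonIm] at hx hy
  exact ⟨by rcases lowerChain_cases x with h | h | h | h | h | h <;> linarith,
    by rcases upperChain_cases x with h | h | h | h | h | h <;> linarith⟩

theorem seeEachOther_dodecagon_10_7 :
    dodecagon.SeeEachOther (dodecagon.openEdge 10) (dodecagon.openEdge 7) := by
  refine seeEachOther_dodecagon (2 / 3) (1 / 2) (by norm_num) (by norm_num) fun r x y h0 h1 hx hy => ?_
  simp [dodecagonRe, dodecagonIm] at hx hy
  exact ⟨by rcases lowerChain_cases x with h | h | h | h | h | h <;> linarith,
    by rcases upperChain_cases x with h | h | h | h | h | h <;> linarith⟩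

theorem seeEachOther_dodecagon_10_4 :
    dodecagon.SeeEachOther (dodecagon.openEdge 10) (dodecagon.openEdge 4) := by
  refine seeEachOther_dodecagon (1 / 2) (1 / 2) (by norm_num) (by norm_num) fun r x y h0 h1 hx hy => ?_
  simp [dodecagonRe, dodecagonIm] at hx hy
  exact ⟨by rcases lowerChain_cases x with h | h | h | h | h | h <;> linarith,
    by rcases upperChain_cases x with h | h | h | h | h | h <;> linarith⟩

theorem seeEachOther_dodecagon_1_7 :
    dodecagon.SeeEachOther (dodecagon.openEdge 1) (dodecagon.openEdge 7) := by
  refine seeEachOther_dodecagon (1 / 2) (1 / 2) (by norm_num) (by norm_num) fun r x y h0 h1 hx hy => ?_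
  simp [dodecagonRe, dodecagonIm] at hx hy
  exact ⟨by rcases lowerChain_cases x with h | h | h | h | h | h <;> linarith,
    by rcases upperChain_cases x with h | h | h | h | h | h <;> linarith⟩

/-! ### Two points that few edges see -/

/-- A line of sight crosses the vertical line `re = c` between the chains. Multiplying by `p.re -
l.re > 0` removes the division, so for fixed `l` and `c` the conditions are linear in `p`. -/
theorem crossing_of_openSegment_subset {l p : ℂ} {c : ℝ} (h : openSegment ℝ l p ⊆ betweenChains)
    (h1 : l.re < c) (h2 : c < p.re) :
    lowerChain c * (p.re - l.re) < l.im * (p.re - l.re) + (p.im - l.im) * (c - l.re) ∧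
      l.im * (p.re - l.re) + (p.im - l.im) * (c - l.re) < upperChain c * (p.re - l.re) := by
  have hpos : 0 < p.re - l.re := by linarith
  have hc : (c - l.re) / (p.re - l.re) * (p.re - l.re) = c - l.re := div_mul_cancel₀ _ hpos.ne'
  set t := (c - l.re) / (p.re - l.re) with ht
  have hz : (⟨c, l.im + t * (p.im - l.im)⟩ : ℂ) ∈ betweenChains := by
    refine h (mem_openSegment_iff_re_im.2 ⟨t, div_pos (by linarith) hpos, ?_, ?_, rfl⟩)
    · rw [ht, div_lt_one hpos]
      linarith
    · dsimp only
      linarith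
  have hm : (l.im + t * (p.im - l.im)) * (p.re - l.re) =
      l.im * (p.re - l.re) + (p.im - l.im) * (c - l.re) := by
    rw [← hc]
    ring
  rw [← hm]
  exact ⟨mul_lt_mul_of_pos_right hz.1 hpos, mul_lt_mul_of_pos_right hz.2 hpos⟩

theorem upperChain_neg_seven : upperChain (-7) = 0 := by
  rcases upperChain_cases (-7) with h | h | h | h | h | h <;> linarith

theorem upperChain_neg_five : upperChain (-5) = 5 := by
  rcases upperChain_cases (-5) with h | h | h | h | h | h <;> linarith

theorem lowerChain_neg_nine : lowerChain (-9) = -6 := by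
  rcases lowerChain_cases (-9) with h | h | h | h | h | h <;> linarith

/-- The view to the right is limited by the vertices (-9, -6) from below and (-7, 0) from above. The
lower limiting ray ends exactly at the vertex (0, 9) and the upper one passes below (-5, 5), so
beyond the gap only edge 8 is visible. -/
theorem eq_of_sees_near_leftmost {i : Fin 12}
    (h : dodecagon.Sees (dodecagon.openEdge i) ⟨-21 / 2, -17 / 2⟩) : i = 11 ∨ i = 8 ∨ i = 0 := by
  obtain ⟨p, hp, h⟩ := h
  rw [inside_dodecagon] at h
  obtain ⟨t, h0, h1, hr, hi⟩ := mem_openEdge_dodecagon.1 hp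
  have hl := fun h2 => (crossing_of_openSegment_subset (c := -9) h (by norm_num) h2).1
  have hu := fun h2 => (crossing_of_openSegment_subset (c := -7) h (by norm_num) h2).2
  rw [lowerChain_neg_nine] at hl
  rw [upperChain_neg_seven] at hu
  dsimp only at hl hu
  clear hp h
  by_contra! hne
  fin_cases i <;> simp [dodecagonRe, dodecagonIm] at hr hi hne
  all_goals first
    | linarith [hl (by linarith)]
    | linarith [hu (by linarith)]

/-- The view out of the spike passes between (-7, 0) and (-5, 5), and both limiting rays land on
edge 1. -/
theorem eq_of_sees_in_left_spike {i : Fin 12}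
    (h : dodecagon.Sees (dodecagon.openEdge i) ⟨-11 / 2, 13 / 2⟩) : i = 10 ∨ i = 9 ∨ i = 1 := by
  obtain ⟨p, hp, h⟩ := h
  rw [inside_dodecagon] at h
  obtain ⟨t, h0, h1, hr, hi⟩ := mem_openEdge_dodecagon.1 hp
  have hu := fun h2 => (crossing_of_openSegment_subset (c := -5) h (by norm_num) h2).2
  -- For guards to the left the segment is reversed, as the crossing lemma runs from left to right.
  have hu' := fun h2 => (crossing_of_openSegment_subset (c := -7) (openSegment_symm ℝ _ p ▸ h) h2
    (by norm_num)).2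
  rw [upperChain_neg_five] at hu
  rw [upperChain_neg_seven] at hu'
  dsimp only at hu hu'
  clear hp h
  by_contra! hne
  fin_cases i <;> simp [dodecagonRe, dodecagonIm] at hr hi hne
  all_goals first
    | linarith [hu (by linarith)]
    | nlinarith [hu' (by linarith)]

theorem near_leftmost_mem_inside : (⟨-21 / 2, -17 / 2⟩ : ℂ) ∈ dodecagon.inside := by
  rw [inside_dodecagon]
  refine ⟨?_, ?_⟩ <;> dsimp only
  · rcases lowerChain_cases (-21 / 2) with h | h | h | h | h | h <;> linarith
  · rcases upperChain_cases (-21 / 2) with h | h | h | h | h | h <;> linarith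

theorem in_left_spike_mem_inside : (⟨-11 / 2, 13 / 2⟩ : ℂ) ∈ dodecagon.inside := by
  rw [inside_dodecagon]
  refine ⟨?_, ?_⟩ <;> dsimp only
  · rcases lowerChain_cases (-11 / 2) with h | h | h | h | h | h <;> linarith
  · rcases upperChain_cases (-11 / 2) with h | h | h | h | h | h <;> linarith

theorem neg_mem_inside_dodecagon {z : ℂ} (hz : z ∈ dodecagon.inside) : -z ∈ dodecagon.inside := by
  rw [inside_dodecagon] at *
  exact neg_mem_betweenChains.2 hz

/-! ### The combinatorial contradiction -/

theorem not_admitsHiddenOpenEdgeGuardSet_dodecagon :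
    ¬ dodecagon.AdmitsHiddenOpenEdgeGuardSet := by
  rintro ⟨S, hg, hh⟩
  have key : ∀ {i j : Fin 12}, i ≠ j →
      dodecagon.SeeEachOther (dodecagon.openEdge i) (dodecagon.openEdge j) → i ∈ S → j ∉ S :=
    fun hij h hi hj => hh _ hi _ hj hij h
  have six (i : Fin 12) : i + 6 + 6 = i := by fin_cases i <;> rfl
  have hA : 11 ∈ S ∨ 8 ∈ S ∨ 0 ∈ S := by
    obtain ⟨i, hi, h⟩ := hg _ near_leftmost_mem_inside
    rcases eq_of_sees_near_leftmost h with rfl | rfl | rfl <;> simp [hi]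
  have hB : 10 ∈ S ∨ 9 ∈ S ∨ 1 ∈ S := by
    obtain ⟨i, hi, h⟩ := hg _ in_left_spike_mem_inside
    rcases eq_of_sees_in_left_spike h with rfl | rfl | rfl <;> simp [hi]
  have hA' : 5 ∈ S ∨ 2 ∈ S ∨ 6 ∈ S := by
    obtain ⟨i, hi, h⟩ := hg _ (neg_mem_inside_dodecagon near_leftmost_mem_inside)
    -- Reflecting the line of sight replaces `i` by `i + 6`; membership in `S` is then read off at
    -- `i + 6 + 6`.
    rw [← six i] at hi
    have h' := h.add_six
    rw [neg_neg] at h'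
    rcases eq_of_sees_near_leftmost h' with h | h | h <;> rw [h] at hi
    exacts [Or.inl hi, Or.inr (Or.inl hi), Or.inr (Or.inr hi)]
  have hB' : 4 ∈ S ∨ 3 ∈ S ∨ 7 ∈ S := by
    obtain ⟨i, hi, h⟩ := hg _ (neg_mem_inside_dodecagon in_left_spike_mem_inside)
    rw [← six i] at hi
    have h' := h.add_six
    rw [neg_neg] at h'
    rcases eq_of_sees_in_left_spike h' with h | h | h <;> rw [h] at hi
    exacts [Or.inl hi, Or.inr (Or.inl hi), Or.inr (Or.inr hi)]
  have h1 := key (by decide) seeEachOther_dodecagon_3_6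
  have h1' : 9 ∈ S → 0 ∉ S := key (by decide) seeEachOther_dodecagon_3_6.add_six
  have h2 := key (by decide) seeEachOther_dodecagon_11_7
  have h2' : 5 ∈ S → 1 ∉ S := key (by decide) seeEachOther_dodecagon_11_7.add_six
  have h3 := key (by decide) seeEachOther_dodecagon_11_4
  have h3' : 5 ∈ S → 10 ∉ S := key (by decide) seeEachOther_dodecagon_11_4.add_six
  have h4 := key (by decide) seeEachOther_dodecagon_11_2
  have h4' : 5 ∈ S → 8 ∉ S := key (by decide) seeEachOther_dodecagon_11_2.add_six
  have h5 := key (by decide) seeEachOther_dodecagon_11_5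
  have h6 := key (by decide) seeEachOther_dodecagon_8_7
  have h6' : 2 ∈ S → 1 ∉ S := key (by decide) seeEachOther_dodecagon_8_7.add_six
  have h7 := key (by decide) seeEachOther_dodecagon_8_4
  have h7' : 2 ∈ S → 10 ∉ S := key (by decide) seeEachOther_dodecagon_8_4.add_six
  have h8 := key (by decide) seeEachOther_dodecagon_8_2
  have h9 := key (by decide) seeEachOther_dodecagon_10_7
  have h9' : 4 ∈ S → 1 ∉ S := key (by decide) seeEachOther_dodecagon_10_7.add_six
  have h10 := key (by decide) seeEachOther_dodecagon_10_4
  have h11 := key (by decide) seeEachOther_dodecagon_1_7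
  -- Each of 11, 8, 5, 2 would force a conflicting pair: 3 and 6, or its mirror image 9 and 0.
  have n11 : 11 ∉ S := fun h =>
    h1 ((hB'.resolve_left (h3 h)).resolve_right (h2 h))
      ((hA'.resolve_left (h5 h)).resolve_left (h4 h))
  have n8 : 8 ∉ S := fun h =>
    h1 ((hB'.resolve_left (h7 h)).resolve_right (h6 h))
      ((hA'.resolve_left fun h' => h4' h' h).resolve_left (h8 h))
  have n5 : 5 ∉ S := fun h =>
    h1' ((hB.resolve_left (h3' h)).resolve_right (h2' h))
      ((hA.resolve_left fun h' => h5 h' h).resolve_left (h4' h))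
  have n2 : 2 ∉ S := fun h =>
    h1' ((hB.resolve_left (h7' h)).resolve_right (h6' h))
      ((hA.resolve_left fun h' => h4 h' h).resolve_left fun h' => h8 h' h)
  have m0 : 0 ∈ S := (hA.resolve_left n11).resolve_left n8
  have m6 : 6 ∈ S := (hA'.resolve_left n5).resolve_left n2
  -- With 0 and 6 in `S`, the edges 9 and 3 drop out; every remaining choice from the two spike
  -- triples is a conflict.
  rcases hB with h | h | h
  · rcases hB' with h' | h' | h'
    exacts [h10 h h', h1 h' m6, h9 h h']
  · exact h1' h m0
  · rcases hB' with h' | h' | h'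
    exacts [h9' h' h, h1 h' m6, h11 h h']

end Polygon

theorem mainTheorem5 :
    ∃ (n : ℕ) (_ : NeZero n) (P : Polygon ℂ n),
      P.IsSimple ∧ P.HasNondegenerateVertices ℝ ∧ P.IsCounterclockwise ∧
      P.IsMonotone ∧ ¬ P.AdmitsHiddenOpenEdgeGuardSet :=
  ⟨12, inferInstance, Polygon.dodecagon, Polygon.dodecagon_isSimple,
    Polygon.dodecagon_hasNondegenerateVertices, Polygon.dodecagon_isCounterclockwise,
    Polygon.dodecagon_isMonotone, Polygon.not_admitsHiddenOpenEdgeGuardSet_dodecagon⟩
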